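/- Let \(n\) be a number of players, \(\phi\in\mathbb R\), \(\kappa\in(0,\infty)\), \(\bar w\in\mathbb R\), and let \(\mathcal G_n\) be the set of matrices \(\mathbf g\in\mathbb R^{n\times n}\) with \(g_{ij}=g_{ji}\in[0,\bar w]\) for all \(i,j\) and \(g_{kk}=0\) for all \(k\). Let \(\hat{\mathbf g}\in\mathcal G_n\) and \(\hat{\mathbf a}\in\mathbb R^n\) be the pre-intervention network and standalone marginal utilities. For a budget \(C\) consider the planner's problem \[ \max_{\mathbf a\in\mathbb R^n,\ \mathbf g\in\mathcal G_n}\ V(\mathbf a,\mathbf g)=\mathbf a^T[\mathbf I-\phi\mathbf g]^{-2}\mathbf a \quad\text{subject to}\quad \kappa\|\mathbf g-\hat{\mathbf g}\|^2+\|\mathbf a-\hat{\mathbf a}\|^2\le C, \] where \(\|\cdot\|\) is the Frobenius norm for matrices and the Euclidean norm for vectors. Here \(V\) is twice the total equilibrium payoff in the game in which player \(i\) chooses \(x_i\in\mathbb R\) and receives \(a_ix_i-\tfrac12x_i^2+\phi\sum_jg_{ij}x_ix_j\). Assume that \[ \bar w<\begin{cases}\dfrac{1}{\phi(n-1)},&\phi>0;\\[1ex]-\dfrac{2}{\phi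 n},&\phi<0\text{ and }n\text{ is even};\\[1ex]-\dfrac{2}{\phi\sqrt{n^2-1}},&\phi<0\text{ and }n\text{ is odd}\end{cases} \] (no condition if \(n\le 1\)). Let \(K_n\) denote the adjacency matrix of the complete graph on \(n\) vertices and \(K_{p,q}\) that of the complete bipartite graph with parts of sizes \(p\) and \(q\). Two matrices \(\mathbf h,\mathbf h'\) are isomorphic, \(\mathbf h\cong\mathbf h'\), if \(h_{ij}=h'_{\sigma(i)\sigma(j)}\) for all \(i,j\), for some bijection \(\sigma\) of the vertices. (a) If \(\phi>0\), there exists \(\overline C\) such that for all \(C>\overline C\) the planner's problem has a solution, and every solution \((\mathbf a^*,\mathbf g^*)\) satisfies \(\mathbf g^*=\bar wK_n\). (b) If \(\phi<0\), there exists \(\overline{\overline C}\) such that for all \(C>\overline{\overline C}\) the planner's problem has a solution, and every solution \((\mathbf a^*,\mathbf g^*)\) satisfies \(\mathbf g^*\cong\bar wK_{\lfloor n/2\rfloor,\lceil n/2\rceil}\). -/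

import Mathlib

namespace NetworkIntervention

open Matrix

/-- The space of weighted networks on `n` players: symmetric matrices with entries in `[0, w]`
and zero diagonal. -/
def networks (n : ℕ) (w : ℝ) : Set (Matrix (Fin n) (Fin n) ℝ) :=
  {g | (∀ i j, g i j = g j i ∧ g i j ∈ Set.Icc 0 w) ∧ ∀ k, g k k = 0}

/-- The payoff of player `i` at the action profile `x`, given standalone marginal utilities `a`. -/
noncomputable def payoff {n : ℕ} (φ : ℝ) (a : Fin n → ℝ) (g : Matrix (Fin n) (Fin n) ℝ)
    (x : Fin n → ℝ) (i : Fin n) : ℝ :=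
  a i * x i - 1 / 2 * x i ^ 2 + φ * ∑ j, g i j * x i * x j

/-- `x` is a (pure) Nash equilibrium: no player gains by changing her own action. -/
def IsEquilibrium {n : ℕ} (φ : ℝ) (a : Fin n → ℝ) (g : Matrix (Fin n) (Fin n) ℝ)
    (x : Fin n → ℝ) : Prop :=
  ∀ i t, payoff φ a g (Function.update x i t) i ≤ payoff φ a g x i

/-- The planner's objective `aᵀ (I - φ g)⁻² a`. -/
noncomputable def welfare {n : ℕ} (φ : ℝ) (a : Fin n → ℝ) (g : Matrix (Fin n) (Fin n) ℝ) : ℝ :=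
  a ⬝ᵥ (((1 - φ • g)⁻¹ ^ 2) *ᵥ a)

/-- On a network without self-loops, an equilibrium satisfies `x = a + φ g x`. -/
theorem IsEquilibrium.eq_best_reply {n : ℕ} {φ : ℝ} {a : Fin n → ℝ}
    {g : Matrix (Fin n) (Fin n) ℝ} (hd : ∀ k, g k k = 0) {x : Fin n → ℝ}
    (hx : IsEquilibrium φ a g x) (i : Fin n) : x i = a i + φ * (g *ᵥ x) i := by
  have hs : ∀ t : ℝ, ∑ j, g i j * (Function.update x i t) i * (Function.update x i t) j
      = t * (g *ᵥ x) i := by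
    intro t
    simp only [mulVec, dotProduct, Finset.mul_sum, Function.update_self]
    refine Finset.sum_congr rfl fun j _ => ?_
    by_cases h : j = i
    · subst h; simp [hd]
    · rw [Function.update_of_ne h]; ring
  have hs0 := hs (x i)
  rw [Function.update_eq_self] at hs0
  have h := hx i (a i + φ * (g *ᵥ x) i)
  unfold payoff at h
  rw [hs, hs0, Function.update_self] at h
  have : (x i - (a i + φ * (g *ᵥ x) i)) ^ 2 ≤ 0 := by nlinarith
  have := pow_eq_zero_iff (two_ne_zero) |>.mp (le_antisymm this (sq_nonneg _))
  linarith

/-- The planner's objective is twice the total payoff in equilibrium. -/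
theorem welfare_eq_two_mul_sum_payoff {n : ℕ} {φ w : ℝ} {a : Fin n → ℝ}
    {g : Matrix (Fin n) (Fin n) ℝ} (hg : g ∈ networks n w) (hu : IsUnit (1 - φ • g).det)
    {x : Fin n → ℝ} (hx : IsEquilibrium φ a g x) :
    welfare φ a g = 2 * ∑ i, payoff φ a g x i := by
  have hbr := hx.eq_best_reply hg.2
  have hsym : gᵀ = g := by ext i j; exact (hg.1 j i).1
  have hp : ∀ i, payoff φ a g x i = 1 / 2 * (x i * x i) := by
    intro i
    have h1 : ∑ j, g i j * x i * x j = x i * (g *ᵥ x) i := by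
      simp only [mulVec, dotProduct, Finset.mul_sum]
      exact Finset.sum_congr rfl fun j _ => by ring
    unfold payoff
    rw [h1]
    linear_combination (-x i) * hbr i
  have ha : a = (1 - φ • g) *ᵥ x := by
    ext i
    simp only [sub_mulVec, one_mulVec, smul_mulVec, Pi.sub_apply, Pi.smul_apply, smul_eq_mul]
    linarith [hbr i]
  have hxa : (1 - φ • g)⁻¹ *ᵥ a = x := by
    rw [ha, mulVec_mulVec, nonsing_inv_mul _ hu, one_mulVec]
  have ht : ((1 - φ • g)⁻¹)ᵀ = (1 - φ • g)⁻¹ := by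
    rw [transpose_nonsing_inv]; simp [hsym]
  have hv : welfare φ a g = x ⬝ᵥ x := by
    unfold welfare
    rw [pow_two, ← mulVec_mulVec, hxa, dotProduct_mulVec, ← mulVec_transpose, ht, hxa]
  rw [hv, Finset.mul_sum]
  simp only [hp, dotProduct]
  exact Finset.sum_congr rfl fun i _ => by ring

/-- The cost of moving from `(a₀, g₀)` to `(a, g)`: the squared Frobenius distance of the networks
times `κ`, plus the squared Euclidean distance of the standalone marginal utilities. -/
def cost {n : ℕ} (κ : ℝ) (a₀ : Fin n → ℝ) (g₀ : Matrix (Fin n) (Fin n) ℝ)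
    (a : Fin n → ℝ) (g : Matrix (Fin n) (Fin n) ℝ) : ℝ :=
  κ * ∑ i, ∑ j, (g i j - g₀ i j) ^ 2 + ∑ i, (a i - a₀ i) ^ 2

/-- The interventions `(a, g)` that the planner can afford with budget `C`. -/
def feasible {n : ℕ} (w κ : ℝ) (a₀ : Fin n → ℝ) (g₀ : Matrix (Fin n) (Fin n) ℝ) (C : ℝ) :
    Set ((Fin n → ℝ) × Matrix (Fin n) (Fin n) ℝ) :=
  {p | p.2 ∈ networks n w ∧ cost κ a₀ g₀ p.1 p.2 ≤ C}

/-- `(a, g)` solves the planner's problem with budget `C`. -/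
def IsOptimal {n : ℕ} (φ w κ : ℝ) (a₀ : Fin n → ℝ) (g₀ : Matrix (Fin n) (Fin n) ℝ) (C : ℝ)
    (a : Fin n → ℝ) (g : Matrix (Fin n) (Fin n) ℝ) : Prop :=
  (a, g) ∈ feasible w κ a₀ g₀ C ∧
    ∀ p ∈ feasible w κ a₀ g₀ C, welfare φ p.1 p.2 ≤ welfare φ a g

/-- The upper bound on the link weights. For `n ≤ 1`, where there are no links and the bounds
below would divide by zero, it imposes nothing. -/
def WeightBound (n : ℕ) (φ w : ℝ) : Prop :=
  2 ≤ n →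
    (0 < φ → w < 1 / (φ * ((n : ℝ) - 1))) ∧
    (φ < 0 → Even n → w < -(2 / (φ * n))) ∧
    (φ < 0 → Odd n → w < -(2 / (φ * √((n : ℝ) ^ 2 - 1))))

/-- The complete graph `K_p`, as its adjacency matrix `J - I`. -/
def completeNetwork (p : ℕ) : Matrix (Fin p) (Fin p) ℝ :=
  Matrix.of (fun _ _ => 1) - 1

/-- The complete bipartite graph `K_{p,q}`, as its adjacency matrix in block form. -/
def completeBipartiteNetwork (p q : ℕ) : Matrix (Fin p ⊕ Fin q) (Fin p ⊕ Fin q) ℝ :=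
  Matrix.fromBlocks 0 (Matrix.of fun _ _ => 1) (Matrix.of fun _ _ => 1) 0

/-- Isomorphism of weighted networks: equality up to a relabelling of the vertices. -/
def NetworkIso {α β : Type*} (h : Matrix α α ℝ) (h' : Matrix β β ℝ) : Prop :=
  ∃ σ : α ≃ β, ∀ i j, h i j = h' (σ i) (σ j)

end NetworkIntervention

open NetworkIntervention

/-! Substitute the equilibrium actions `x` for the standalone utilities, `a = (I - φg)x`. The
objective becomes `|x|²`, whatever the network, and the cost becomes `κ|g - g₀|² + |(I - φg)x -
a₀|²`. Let `l < 1` be the maximum of `φ xᵀgx` over networks and unit vectors. By Cauchy-Schwarz `|(I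
- φg)x| ≥ (1 - l)|x|`, with equality at an extremal eigenvector. A large budget forces `|x|` to be
large, while comparison with that eigenvector keeps the residual within a constant of `(1 - l)|x|`
(`IsActionOptimal.residual_le`).

By compactness (`exists_residual_bound`), the direction of `x` then behaves like an exact extremal
vector, for which the residual is a positive multiple of the vector. In the first-order condition
for a link `ij`, the marginal effect on the residual has the sign of `φ xᵢxⱼ` and order `|x|²`,
whereas the marginal adjustment cost is bounded. Hence every link is at `w` or `0` according to that
sign (`exists_budget_forall_isOptimal`).

It remains to find the sign patterns of near-maximizers. The form is bounded in terms of the numbers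
of positive and negative entries only, so the wrong patterns lose a fixed amount. For `φ > 0` all
signs agree; for `φ < 0` they split as evenly as possible (`dotProduct_mulVec_le_of_numPos_le`,
`neg_dotProduct_mulVec_le`). -/

namespace NetworkIntervention
open Matrix

/-- The Euclidean norm of a vector of actions. -/
noncomputable def euclNorm {n : ℕ} (x : Fin n → ℝ) : ℝ := ‖WithLp.toLp 2 x‖

/-! ### Euclidean norm and Cauchy-Schwarz. -/

section EuclNorm
variable {n : ℕ}

theorem euclNorm_nonneg (x : Fin n → ℝ) : 0 ≤ euclNorm x := norm_nonneg _

theorem euclNorm_sq (x : Fin n → ℝ) : euclNorm x ^ 2 = x ⬝ᵥ x := by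
  rw [euclNorm, EuclideanSpace.norm_sq_eq]
  simp [dotProduct, pow_two]

theorem euclNorm_smul (c : ℝ) (x : Fin n → ℝ) : euclNorm (c • x) = |c| * euclNorm x := by
  simp [euclNorm, norm_smul]

theorem euclNorm_sub_le (x y : Fin n → ℝ) : euclNorm (x - y) ≤ euclNorm x + euclNorm y := by
  simpa [euclNorm] using norm_sub_le (WithLp.toLp 2 x) (WithLp.toLp 2 y)

theorem euclNorm_le_add (x y : Fin n → ℝ) : euclNorm x ≤ euclNorm (x - y) + euclNorm y := by
  simpa [euclNorm] using norm_add_le (WithLp.toLp 2 (x - y)) (WithLp.toLp 2 y)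

theorem dotProduct_le_euclNorm (x y : Fin n → ℝ) : x ⬝ᵥ y ≤ euclNorm x * euclNorm y := by
  have h := real_inner_le_norm (WithLp.toLp 2 x) (WithLp.toLp 2 y)
  simpa [euclNorm, EuclideanSpace.inner_eq_star_dotProduct, dotProduct_comm] using h

theorem abs_apply_le_euclNorm (x : Fin n → ℝ) (i : Fin n) : |x i| ≤ euclNorm x := by
  simpa [euclNorm] using PiLp.norm_apply_le (WithLp.toLp 2 x) i

theorem euclNorm_pos {x : Fin n → ℝ} (hx : x ≠ 0) : 0 < euclNorm x := by
  simpa [euclNorm] using hx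

theorem euclNorm_eq_zero {x : Fin n → ℝ} : euclNorm x = 0 ↔ x = 0 := by
  simp [euclNorm]

theorem continuous_euclNorm : Continuous (euclNorm : (Fin n → ℝ) → ℝ) :=
  (PiLp.continuous_toLp 2 _).norm

/-- Equality case of the Cauchy-Schwarz inequality with a unit vector. -/
theorem eq_smul_of_le_dotProduct {u y : Fin n → ℝ} {m : ℝ} (hu : u ⬝ᵥ u = 1)
    (hy : y ⬝ᵥ y ≤ m ^ 2) (hm : 0 ≤ m) (huy : m ≤ u ⬝ᵥ y) : y = m • u := by
  have hle : u ⬝ᵥ y ≤ m := by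
    have h := dotProduct_le_euclNorm u y
    have h1 : euclNorm u = 1 := by
      have := euclNorm_sq u
      nlinarith [euclNorm_nonneg u]
    have h2 : euclNorm y ≤ m := by
      rw [← euclNorm_sq] at hy
      exact le_of_sq_le_sq hy hm
    rw [h1, one_mul] at h
    exact h.trans h2
  have h0 : (y - m • u) ⬝ᵥ (y - m • u) ≤ 0 := by
    simp only [sub_dotProduct, dotProduct_sub, smul_dotProduct, dotProduct_smul, smul_eq_mul, hu,
      dotProduct_comm y u]
    nlinarith
  rw [← euclNorm_sq] at h0
  exact sub_eq_zero.mp (euclNorm_eq_zero.mp (pow_eq_zero_iff two_ne_zero |>.mp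
    (le_antisymm h0 (sq_nonneg _))))

end EuclNorm

/-! ### Reduction to equilibrium actions and existence of solutions. -/

section Networks
variable {n : ℕ} {φ w κ : ℝ}

theorem isClosed_networks (n : ℕ) (w : ℝ) : IsClosed (networks n w) := by
  have he : ∀ i j : Fin n, Continuous fun g : Matrix (Fin n) (Fin n) ℝ => g i j :=
    fun i j => continuous_id.matrix_elem i j
  have : networks n w = ⋂ i : Fin n, ⋂ j : Fin n,
      {g : Matrix (Fin n) (Fin n) ℝ | g i j = g j i} ∩ (fun g => g i j) ⁻¹' Set.Icc 0 w ∩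
        {g | g i i = 0} := by
    ext g
    rw [Set.mem_iInter]
    simp only [Set.mem_iInter]
    exact ⟨fun h i j => ⟨⟨(h.1 i j).1, (h.1 i j).2⟩, h.2 i⟩,
      fun h => ⟨fun i j => ⟨(h i j).1.1, (h i j).1.2⟩, fun k => (h k k).2⟩⟩
  rw [this]
  exact isClosed_iInter fun i => isClosed_iInter fun j =>
    ((isClosed_eq (he i j) (he j i)).inter (isClosed_Icc.preimage (he i j))).inter
      (isClosed_eq (he i i) continuous_const)

theorem isCompact_networks (n : ℕ) (w : ℝ) : IsCompact (networks n w) := by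
  have hbox : IsCompact (Set.univ.pi fun _ : Fin n => Set.univ.pi fun _ : Fin n =>
      Set.Icc (0 : ℝ) w) :=
    isCompact_univ_pi fun _ => isCompact_univ_pi fun _ => isCompact_Icc
  exact IsCompact.of_isClosed_subset (X := Matrix (Fin n) (Fin n) ℝ) hbox
    (isClosed_networks n w) fun g hg i _ j _ => (hg.1 i j).2

theorem one_sub_smul_mulVec_apply (φ : ℝ) (g : Matrix (Fin n) (Fin n) ℝ) (x : Fin n → ℝ)
    (i : Fin n) : ((1 - φ • g) *ᵥ x) i = x i - φ * (g *ᵥ x) i := by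
  simp [sub_mulVec, smul_mulVec]

theorem dotProduct_one_sub_smul_mulVec (φ : ℝ) (g : Matrix (Fin n) (Fin n) ℝ) (x : Fin n → ℝ) :
    x ⬝ᵥ (1 - φ • g) *ᵥ x = x ⬝ᵥ x - φ * (x ⬝ᵥ g *ᵥ x) := by
  simp [sub_mulVec, smul_mulVec, dotProduct_sub]

/-- Cauchy-Schwarz for `x` and `(1 - φ • g) *ᵥ x`: their inner product is at least `(1 - l)|x|²`. It
is used with `l` for invertibility and compactness, and with the smaller `l'` to exclude wrong sign
patterns. -/
theorem sub_mul_euclNorm_le {l : ℝ} {g : Matrix (Fin n) (Fin n) ℝ} {x : Fin n → ℝ}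
    (h : φ * (x ⬝ᵥ g *ᵥ x) ≤ l * (x ⬝ᵥ x)) :
    (1 - l) * euclNorm x ≤ euclNorm ((1 - φ • g) *ᵥ x) := by
  by_cases hx : x = 0
  · subst hx; simp [euclNorm]
  have h1 := dotProduct_le_euclNorm x ((1 - φ • g) *ᵥ x)
  rw [dotProduct_one_sub_smul_mulVec] at h1
  have h2 := euclNorm_sq x
  have h3 := euclNorm_pos hx
  refine le_of_mul_le_mul_left ?_ h3
  rw [← h2] at h h1
  linarith

/-- The quadratic forms of the networks, scaled by `φ`, are bounded by `l`. -/
def FormBound (n : ℕ) (φ w l : ℝ) : Prop :=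
  ∀ g ∈ networks n w, ∀ x : Fin n → ℝ, φ * (x ⬝ᵥ g *ᵥ x) ≤ l * (x ⬝ᵥ x)

theorem FormBound.isUnit_det {l : ℝ} (h : FormBound n φ w l) (hl : l < 1)
    {g : Matrix (Fin n) (Fin n) ℝ} (hg : g ∈ networks n w) : IsUnit (1 - φ • g).det := by
  rw [← Matrix.isUnit_iff_isUnit_det, ← Matrix.mulVec_injective_iff_isUnit]
  intro x y hxy
  have h0 : (1 - φ • g) *ᵥ (x - y) = 0 := by rw [mulVec_sub]; exact sub_eq_zero.mpr hxy
  have h1 := sub_mul_euclNorm_le (h g hg (x - y))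
  rw [h0, euclNorm_eq_zero.mpr rfl] at h1
  have h2 : euclNorm (x - y) = 0 := by nlinarith [euclNorm_nonneg (x - y)]
  exact sub_eq_zero.mp (euclNorm_eq_zero.mp h2)

theorem welfare_mulVec {g : Matrix (Fin n) (Fin n) ℝ} (hg : g ∈ networks n w)
    (hu : IsUnit (1 - φ • g).det) (x : Fin n → ℝ) :
    welfare φ ((1 - φ • g) *ᵥ x) g = x ⬝ᵥ x := by
  have hsym : gᵀ = g := by ext i j; exact (hg.1 j i).1
  have hxa : (1 - φ • g)⁻¹ *ᵥ ((1 - φ • g) *ᵥ x) = x := by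
    rw [mulVec_mulVec, nonsing_inv_mul _ hu, one_mulVec]
  have ht : ((1 - φ • g)⁻¹)ᵀ = (1 - φ • g)⁻¹ := by
    rw [transpose_nonsing_inv]; simp [hsym]
  unfold welfare
  rw [pow_two, ← mulVec_mulVec, hxa, dotProduct_mulVec, ← mulVec_transpose, ht, hxa]

/-- The cost of the intervention that results in the network `g` and the equilibrium actions `x`. -/
def actionCost (φ κ : ℝ) (a₀ : Fin n → ℝ) (g₀ : Matrix (Fin n) (Fin n) ℝ)
    (x : Fin n → ℝ) (g : Matrix (Fin n) (Fin n) ℝ) : ℝ :=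
  cost κ a₀ g₀ ((1 - φ • g) *ᵥ x) g

/-- The planner's problem in terms of the equilibrium actions instead of the standalone marginal
utilities. -/
def IsActionOptimal (φ w κ : ℝ) (a₀ : Fin n → ℝ) (g₀ : Matrix (Fin n) (Fin n) ℝ) (C : ℝ)
    (x : Fin n → ℝ) (g : Matrix (Fin n) (Fin n) ℝ) : Prop :=
  (g ∈ networks n w ∧ actionCost φ κ a₀ g₀ x g ≤ C) ∧
    ∀ x', ∀ g' ∈ networks n w, actionCost φ κ a₀ g₀ x' g' ≤ C → x' ⬝ᵥ x' ≤ x ⬝ᵥ x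

variable {a₀ : Fin n → ℝ} {g₀ : Matrix (Fin n) (Fin n) ℝ} {C l : ℝ}

/-- For each network `x ↦ (1 - φ • g) *ᵥ x` is a bijection that turns `|x|²` into the welfare, so
the two problems correspond. -/
theorem isOptimal_mulVec_iff (h : FormBound n φ w l) (hl : l < 1)
    {g : Matrix (Fin n) (Fin n) ℝ} (x : Fin n → ℝ) :
    IsOptimal φ w κ a₀ g₀ C ((1 - φ • g) *ᵥ x) g ↔ IsActionOptimal φ w κ a₀ g₀ C x g := by
  refine and_congr_right fun hf => ⟨fun H x' g' hg' hc => ?_, fun H p hp => ?_⟩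
  · have := H ((1 - φ • g') *ᵥ x', g') ⟨hg', hc⟩
    rwa [welfare_mulVec hg' (h.isUnit_det hl hg'), welfare_mulVec hf.1 (h.isUnit_det hl hf.1)] at this
  · have hu := h.isUnit_det hl hp.1
    have hp1 : (1 - φ • p.2) *ᵥ ((1 - φ • p.2)⁻¹ *ᵥ p.1) = p.1 := by
      rw [mulVec_mulVec, mul_nonsing_inv _ hu, one_mulVec]
    have := H ((1 - φ • p.2)⁻¹ *ᵥ p.1) p.2 hp.1 (by unfold actionCost; rw [hp1]; exact hp.2)
    rwa [← welfare_mulVec hp.1 hu, ← welfare_mulVec hf.1 (h.isUnit_det hl hf.1), hp1] at this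

theorem IsOptimal.exists_isActionOptimal (h : FormBound n φ w l) (hl : l < 1) {a : Fin n → ℝ}
    {g : Matrix (Fin n) (Fin n) ℝ} (ho : IsOptimal φ w κ a₀ g₀ C a g) :
    ∃ x, IsActionOptimal φ w κ a₀ g₀ C x g := by
  have hu := h.isUnit_det hl ho.1.1
  have hp1 : (1 - φ • g) *ᵥ ((1 - φ • g)⁻¹ *ᵥ a) = a := by
    rw [mulVec_mulVec, mul_nonsing_inv _ hu, one_mulVec]
  exact ⟨_, (isOptimal_mulVec_iff h hl _).mp (by rwa [hp1])⟩

theorem continuous_actionCost (φ κ : ℝ) (a₀ : Fin n → ℝ) (g₀ : Matrix (Fin n) (Fin n) ℝ) :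
    Continuous fun p : (Fin n → ℝ) × Matrix (Fin n) (Fin n) ℝ =>
      actionCost φ κ a₀ g₀ p.1 p.2 := by
  have he : ∀ i j : Fin n, Continuous fun p : (Fin n → ℝ) × Matrix (Fin n) (Fin n) ℝ => p.2 i j :=
    fun i j => continuous_snd.matrix_elem i j
  unfold actionCost cost
  simp only [mulVec, dotProduct]
  fun_prop

theorem sq_sum_eq_euclNorm (a b : Fin n → ℝ) : ∑ i, (a i - b i) ^ 2 = euclNorm (a - b) ^ 2 := by
  rw [euclNorm_sq]
  exact Finset.sum_congr rfl fun i _ => by simp [pow_two]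

theorem sq_euclNorm_le_actionCost (hκ : 0 ≤ κ) (x : Fin n → ℝ) (g : Matrix (Fin n) (Fin n) ℝ) :
    euclNorm ((1 - φ • g) *ᵥ x - a₀) ^ 2 ≤ actionCost φ κ a₀ g₀ x g := by
  unfold actionCost cost
  rw [sq_sum_eq_euclNorm]
  have : 0 ≤ κ * ∑ i, ∑ j, (g i j - g₀ i j) ^ 2 := by positivity
  linarith

/-- The budget bounds the residual, and `l < 1` turns this into a bound on `x`, so the feasible set
is compact. It contains the status quo, whose cost is zero. -/
theorem exists_isActionOptimal (hκ : 0 ≤ κ) (hg₀ : g₀ ∈ networks n w) (h : FormBound n φ w l)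
    (hl : l < 1) (hC : 0 ≤ C) : ∃ x g, IsActionOptimal φ w κ a₀ g₀ C x g := by
  set R : ℝ := (√C + euclNorm a₀) / (1 - l)
  set K : Set ((Fin n → ℝ) × Matrix (Fin n) (Fin n) ℝ) :=
    {p | p.2 ∈ networks n w ∧ actionCost φ κ a₀ g₀ p.1 p.2 ≤ C}
  have hbd : ∀ p ∈ K, p.1 ∈ Set.univ.pi fun _ : Fin n => Set.Icc (-R) R := by
    intro p hp i _
    have h1 : euclNorm ((1 - φ • p.2) *ᵥ p.1 - a₀) ≤ √C :=
      Real.le_sqrt_of_sq_le ((sq_euclNorm_le_actionCost hκ _ _).trans hp.2)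
    have h2 := euclNorm_le_add ((1 - φ • p.2) *ᵥ p.1) a₀
    have h3 := sub_mul_euclNorm_le (h p.2 hp.1 p.1)
    have h4 : euclNorm p.1 ≤ R := by
      rw [le_div_iff₀ (by linarith)]
      linarith
    exact abs_le.mp ((abs_apply_le_euclNorm p.1 i).trans h4)
  have hK : IsCompact K := by
    have hbox : IsCompact ((Set.univ.pi fun _ : Fin n => Set.Icc (-R) R) ×ˢ networks n w) :=
      (isCompact_univ_pi fun _ => isCompact_Icc).prod (isCompact_networks n w)
    have : K = ((Set.univ.pi fun _ : Fin n => Set.Icc (-R) R) ×ˢ networks n w) ∩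
        {p | actionCost φ κ a₀ g₀ p.1 p.2 ≤ C} := by
      ext p
      exact ⟨fun hp => ⟨⟨hbd p hp, hp.1⟩, hp.2⟩, fun hp => ⟨hp.1.2, hp.2⟩⟩
    rw [this]
    exact hbox.inter_right (isClosed_le (continuous_actionCost φ κ a₀ g₀) continuous_const)
  have hne : K.Nonempty := by
    have hu := h.isUnit_det hl hg₀
    refine ⟨((1 - φ • g₀)⁻¹ *ᵥ a₀, g₀), hg₀, ?_⟩
    simp only [actionCost, mulVec_mulVec, mul_nonsing_inv _ hu, one_mulVec]
    simpa [cost] using hC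
  obtain ⟨p, hp, hmax⟩ := hK.exists_isMaxOn hne
    (f := fun p => p.1 ⬝ᵥ p.1) (by simp only [dotProduct]; fun_prop)
  exact ⟨p.1, p.2, hp, fun x' g' hg' hc => hmax (a := (x', g')) ⟨hg', hc⟩⟩

/-- At an optimum, the network is the cheapest one that supports the equilibrium actions. -/
theorem IsActionOptimal.actionCost_le {x : Fin n → ℝ} {g : Matrix (Fin n) (Fin n) ℝ}
    (ho : IsActionOptimal φ w κ a₀ g₀ C x g) (hx : x ≠ 0) {g' : Matrix (Fin n) (Fin n) ℝ}
    (hg' : g' ∈ networks n w) :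
    actionCost φ κ a₀ g₀ x g ≤ actionCost φ κ a₀ g₀ x g' := by
  by_contra! hlt
  -- A cheaper network would leave slack in the budget, which pays for scaling `x` by some `s > 1`.
  have hc : Continuous fun s : ℝ => actionCost φ κ a₀ g₀ (s • x) g' :=
    (continuous_actionCost φ κ a₀ g₀).comp (f := fun s : ℝ => (s • x, g')) (by fun_prop)
  have h1 : ∀ᶠ s in nhds (1 : ℝ), actionCost φ κ a₀ g₀ (s • x) g' < C :=
    hc.continuousAt.eventually_lt_const (by simpa using hlt.trans_le ho.1.2)
  have h2 : ∀ᶠ s in nhdsWithin (1 : ℝ) (Set.Ioi 1), 1 < s := self_mem_nhdsWithin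
  obtain ⟨s, hs1, hs⟩ := ((h1.filter_mono nhdsWithin_le_nhds).and h2).exists
  have h3 := ho.2 (s • x) g' hg' hs1.le
  have h4 := euclNorm_sq x
  have h5 := euclNorm_pos hx
  simp only [← euclNorm_sq, euclNorm_smul, mul_pow, sq_abs] at h3
  nlinarith [mul_pos h5 h5, mul_pos (sub_pos.mpr hs) (mul_pos h5 h5)]

end Networks
end NetworkIntervention

/-! ### Large budgets: near-extremal actions and first-order conditions. -/

namespace NetworkIntervention
open Matrix

/-- A continuous function that is positive where `f ≤ m` on a compact set is bounded below
where `f` is nearly at most `m`. -/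
theorem exists_pos_le_of_isCompact {X ι : Type*} [TopologicalSpace X] [Finite ι] {K : Set X}
    (hK : IsCompact K) {f : X → ℝ} (hf : Continuous f) {h : ι → X → ℝ}
    (hh : ∀ i, Continuous (h i)) {m : ℝ} (H : ∀ x ∈ K, f x ≤ m → ∀ i, 0 < h i x) :
    ∃ ε > 0, ∀ x ∈ K, f x ≤ m + ε → ∀ i, ε ≤ h i x := by
  have hone : ∀ i, ∃ ε > 0, ∀ x ∈ K, f x ≤ m + ε → ε ≤ h i x := by
    intro i
    rcases K.eq_empty_or_nonempty with rfl | hne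
    · exact ⟨1, one_pos, by simp⟩
    -- The hypothesis says that `max (f - m) (h i)` is positive on `K`; half its minimum serves as
    -- `ε`.
    obtain ⟨p, hp, hmin⟩ := hK.exists_isMinOn hne (f := fun x => max (f x - m) (h i x))
      ((hf.sub continuous_const).max (hh i)).continuousOn
    have hpos : 0 < max (f p - m) (h i p) := by
      rcases le_or_gt (f p) m with hle | hlt
      · exact lt_max_of_lt_right (H p hp hle i)
      · exact lt_max_of_lt_left (sub_pos.mpr hlt)
    refine ⟨max (f p - m) (h i p) / 2, by positivity, fun x hx hfx => ?_⟩
    have hle : max (f p - m) (h i p) ≤ max (f x - m) (h i x) := hmin hx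
    rcases le_max_iff.mp hle with h1 | h1 <;> linarith
  have hev : ∀ i, ∀ᶠ ε in nhdsWithin (0 : ℝ) (Set.Ioi 0),
      ∀ x ∈ K, f x ≤ m + ε → ε ≤ h i x := by
    intro i
    obtain ⟨e, he, hi⟩ := hone i
    filter_upwards [Ioo_mem_nhdsGT he] with ε hε x hx hfx
    exact hε.2.le.trans (hi x hx (by linarith [hε.2]))
  obtain ⟨ε, hε, hpos⟩ := ((Filter.eventually_all.mpr hev).and self_mem_nhdsWithin).exists
  exact ⟨ε, hpos, fun x hx hfx i => hε i x hx hfx⟩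

variable {n : ℕ} {φ w κ C l l' : ℝ} {a₀ : Fin n → ℝ} {g₀ : Matrix (Fin n) (Fin n) ℝ}

/-- Near-optimal pairs of a unit action profile and a network have nonzero actions, bounded away
from zero, and residuals of the same sign. -/
theorem exists_residual_bound (hl : l < 1) (hl' : l' < l) {Q : (Fin n → ℝ) → Prop}
    (hQ : ∀ x, Q x → ∀ i, x i ≠ 0)
    (hgap : ∀ g ∈ networks n w, ∀ x : Fin n → ℝ, Q x ∨ φ * (x ⬝ᵥ g *ᵥ x) ≤ l' * (x ⬝ᵥ x))
    (h : FormBound n φ w l) :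
    ∃ ε > 0, ∀ g ∈ networks n w, ∀ u : Fin n → ℝ, u ⬝ᵥ u = 1 →
      euclNorm ((1 - φ • g) *ᵥ u) ≤ 1 - l + ε → ∀ i j,
        ε ≤ (((1 - φ • g) *ᵥ u) i * u j + ((1 - φ • g) *ᵥ u) j * u i) * (u i * u j) := by
  have hsphere : IsCompact {u : Fin n → ℝ | u ⬝ᵥ u = 1} := by
    refine IsCompact.of_isClosed_subset
      (isCompact_univ_pi fun _ : Fin n => isCompact_Icc (a := (-1 : ℝ)) (b := 1)) ?_ ?_
    · exact isClosed_eq (by simp only [dotProduct]; fun_prop) continuous_const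
    · intro u hu i _
      have h1 := euclNorm_sq u
      rw [show u ⬝ᵥ u = 1 from hu] at h1
      have h2 : euclNorm u = 1 := by nlinarith [euclNorm_nonneg u]
      exact abs_le.mp (h2 ▸ abs_apply_le_euclNorm u i)
  have hcv : Continuous fun p : (Fin n → ℝ) × Matrix (Fin n) (Fin n) ℝ =>
      (1 - φ • p.2) *ᵥ p.1 := by fun_prop
  have hci : ∀ i, Continuous fun p : (Fin n → ℝ) × Matrix (Fin n) (Fin n) ℝ =>
      ((1 - φ • p.2) *ᵥ p.1) i := fun i => (continuous_apply i).comp hcv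
  obtain ⟨ε, hε, H⟩ := exists_pos_le_of_isCompact (ι := Fin n × Fin n)
    (hsphere.prod (isCompact_networks n w)) (continuous_euclNorm.comp hcv)
    (h := fun ij p => (((1 - φ • p.2) *ᵥ p.1) ij.1 * p.1 ij.2 +
      ((1 - φ • p.2) *ᵥ p.1) ij.2 * p.1 ij.1) * (p.1 ij.1 * p.1 ij.2))
    (fun ij => by have := hci ij.1; have := hci ij.2; fun_prop) (m := 1 - l) (by
      rintro ⟨u, g⟩ ⟨hu : u ⬝ᵥ u = 1, hg⟩ hle ⟨i, j⟩
      have hle : euclNorm ((1 - φ • g) *ᵥ u) ≤ 1 - l := hle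
      have hform := h g hg u
      have hdot := dotProduct_one_sub_smul_mulVec φ g u
      rw [hu] at hform hdot
      -- Here `u · y ≥ 1 - l ≥ |y|` for the residual `y`, which is the equality case of
      -- Cauchy-Schwarz. The quantity to be bounded is then `2(1 - l)(uᵢuⱼ)²`.
      have hy : (1 - φ • g) *ᵥ u = (1 - l) • u := by
        refine eq_smul_of_le_dotProduct hu ?_ (by linarith) (by linarith)
        rw [← euclNorm_sq]
        exact pow_le_pow_left₀ (euclNorm_nonneg _) hle 2
      have hq : Q u := by
        refine (hgap g hg u).resolve_right fun hcon => ?_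
        rw [hy, dotProduct_smul, hu, smul_eq_mul] at hdot
        rw [hu] at hcon
        linarith
      have hi := hQ u hq i
      have hj := hQ u hq j
      have h1l : 0 < 1 - l := by linarith
      simp only [hy, Pi.smul_apply, smul_eq_mul]
      have : 0 < 2 * (1 - l) * (u i * u j) ^ 2 := by positivity
      linarith)
  exact ⟨ε, hε, fun g hg u hu hle i j => H (u, g) ⟨hu, hg⟩ hle (i, j)⟩

/-- The residual is affine in the network, so the cost is exactly quadratic in `t`. -/
theorem actionCost_add_smul (φ κ : ℝ) (a₀ : Fin n → ℝ) (g₀ : Matrix (Fin n) (Fin n) ℝ)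
    (x : Fin n → ℝ) (g P : Matrix (Fin n) (Fin n) ℝ) (t : ℝ) :
    actionCost φ κ a₀ g₀ x (g + t • P) = actionCost φ κ a₀ g₀ x g +
      t * (2 * κ * ∑ i, ∑ j, P i j * (g i j - g₀ i j) -
        2 * φ * (((1 - φ • g) *ᵥ x - a₀) ⬝ᵥ P *ᵥ x)) +
      t ^ 2 * (κ * ∑ i, ∑ j, P i j ^ 2 + φ ^ 2 * ∑ i, (P *ᵥ x) i ^ 2) := by
  have h1 : ∑ i, ∑ j, ((g + t • P) i j - g₀ i j) ^ 2 = ∑ i, ∑ j, (g i j - g₀ i j) ^ 2 +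
      2 * t * ∑ i, ∑ j, P i j * (g i j - g₀ i j) + t ^ 2 * ∑ i, ∑ j, P i j ^ 2 := by
    simp only [Finset.mul_sum, ← Finset.sum_add_distrib, Matrix.add_apply, Matrix.smul_apply, smul_eq_mul]
    exact Finset.sum_congr rfl fun i _ => Finset.sum_congr rfl fun j _ => by ring
  have h2 : ∑ i, (((1 - φ • (g + t • P)) *ᵥ x) i - a₀ i) ^ 2 =
      ∑ i, (((1 - φ • g) *ᵥ x) i - a₀ i) ^ 2 -
      2 * t * φ * (((1 - φ • g) *ᵥ x - a₀) ⬝ᵥ P *ᵥ x) + t ^ 2 * φ ^ 2 * ∑ i, (P *ᵥ x) i ^ 2 := by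
    simp only [dotProduct, Finset.mul_sum, ← Finset.sum_add_distrib, ← Finset.sum_sub_distrib]
    refine Finset.sum_congr rfl fun i _ => ?_
    simp only [one_sub_smul_mulVec_apply, add_mulVec, smul_mulVec, Pi.add_apply, Pi.smul_apply,
      Pi.sub_apply, smul_eq_mul]
    ring
  unfold actionCost cost
  rw [h1, h2]
  ring

/-- First-order conditions for the weight of a single link at an optimum. -/
theorem IsActionOptimal.first_order (hg₀ : g₀ ∈ networks n w)
    {x : Fin n → ℝ} {g : Matrix (Fin n) (Fin n) ℝ}
    (ho : IsActionOptimal φ w κ a₀ g₀ C x g) (hx : x ≠ 0) (hκ : 0 ≤ κ) {i j : Fin n} (hij : i ≠ j)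
    {Y : Fin n → ℝ} (hY : Y = (1 - φ • g) *ᵥ x - a₀) :
    (2 * κ * (g i j - g₀ i j) < φ * (x j * Y i + x i * Y j) → g i j = w) ∧
    (φ * (x j * Y i + x i * Y j) < 2 * κ * (g i j - g₀ i j) → g i j = 0) := by
  have hg := ho.1.1
  -- A link occupies two symmetric entries, which must move together.
  set P : Matrix (Fin n) (Fin n) ℝ := single i j 1 + single j i 1
  have hP1 : ∑ k, ∑ m, P k m * (g k m - g₀ k m) = 2 * (g i j - g₀ i j) := by
    have hs : ∀ p q : Fin n, ∑ k, ∑ m, single p q (1 : ℝ) k m * (g k m - g₀ k m)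
        = g p q - g₀ p q := by
      intro p q
      rw [Finset.sum_eq_single p _ (by simp), Finset.sum_eq_single q _ (by simp)]
      · simp
      · intro b _ hb; simp [hb.symm]
      · intro b _ hb; simp [hb.symm]
    simp only [P, Matrix.add_apply, add_mul, Finset.sum_add_distrib, hs]
    rw [(hg.1 j i).1, (hg₀.1 j i).1]
    ring
  have hP2 : Y ⬝ᵥ P *ᵥ x = x j * Y i + x i * Y j := by
    have hs : ∀ p q : Fin n, Y ⬝ᵥ single p q (1 : ℝ) *ᵥ x = x q * Y p := by
      intro p q
      simp [single_mulVec, dotProduct, Function.update_apply, mul_comm]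
    simp only [P, add_mulVec, dotProduct_add, hs]
  set e := κ * ∑ i, ∑ j, P i j ^ 2 + φ ^ 2 * ∑ i, (P *ᵥ x) i ^ 2
  have he : 0 ≤ e := by positivity
  set d := 4 * κ * (g i j - g₀ i j) - 2 * φ * (x j * Y i + x i * Y j) with hd
  have key : ∀ t : ℝ, 0 ≤ g i j + t → g i j + t ≤ w → 0 ≤ t * d + t ^ 2 * e := by
    intro t h0 h1
    have hmem : g + t • P ∈ networks n w := by
      have hsymm : ∀ k m, P k m = P m k := by
        intro k m
        simp only [P, Matrix.add_apply, single_apply]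
        rw [add_comm]
        simp only [and_comm]
      refine ⟨fun k m => ⟨?_, ?_⟩, fun k => ?_⟩
      · simp only [Matrix.add_apply, Matrix.smul_apply, (hg.1 k m).1, hsymm k m]
      · have hcase : (g + t • P) k m = g k m ∨ (g + t • P) k m = g i j + t := by
          simp only [P, Matrix.add_apply, Matrix.smul_apply, single_apply, smul_eq_mul]
          by_cases hc : i = k ∧ j = m
          · have : ¬(j = k ∧ i = m) := fun hc' => hij (hc.1.trans hc'.1.symm)
            right; rw [if_pos hc, if_neg this, hc.1, hc.2]; ring
          · by_cases hc' : j = k ∧ i = m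
            · right; rw [if_neg hc, if_pos hc', (hg.1 i j).1, hc'.1, hc'.2]; ring
            · left; rw [if_neg hc, if_neg hc']; ring
        rcases hcase with hc | hc <;> rw [hc]
        exacts [(hg.1 k m).2, ⟨h0, h1⟩]
      · have h2 : ¬(i = k ∧ j = k) := fun hc => hij (hc.1.trans hc.2.symm)
        have h3 : ¬(j = k ∧ i = k) := fun hc => hij (hc.2.trans hc.1.symm)
        simp [P, hg.2 k, h2, h3]
    have hle := ho.actionCost_le hx hmem
    rw [actionCost_add_smul, hP1, ← hY, hP2] at hle
    linarith
  have hw0 := (hg.1 i j).2.1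
  have hw1 := (hg.1 i j).2.2
  -- A step short enough for the linear gain `D` to beat the quadratic term.
  have small : ∀ b : ℝ, 0 < b → ∀ D : ℝ, 0 < D → ∃ t, 0 < t ∧ t ≤ b ∧ t * e < D := by
    intro b hb D hD
    refine ⟨min b (D / (e + 1)), by positivity, min_le_left _ _, ?_⟩
    calc min b (D / (e + 1)) * e ≤ D / (e + 1) * e := by gcongr; exact min_le_right _ _
      _ < D / (e + 1) * (e + 1) := by gcongr; linarith
      _ = D := by field_simp
  constructor
  · intro hlt
    by_contra hne
    have hlt' : g i j < w := lt_of_le_of_ne hw1 hne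
    obtain ⟨t, ht, htb, hte⟩ := small (w - g i j) (by linarith) (-d) (by rw [hd]; linarith)
    have := key t (by linarith) (by linarith)
    nlinarith
  · intro hlt
    by_contra hne
    have hlt' : 0 < g i j := lt_of_le_of_ne hw0 (Ne.symm hne)
    obtain ⟨t, ht, htb, hte⟩ := small (g i j) hlt' d (by rw [hd]; linarith)
    have := key (-t) (by linarith) (by linarith)
    nlinarith

/-- With an eigenvector of a network at hand, the residual at an optimum is almost minimal. -/
theorem IsActionOptimal.residual_le {u₀ : Fin n → ℝ} {g₁ : Matrix (Fin n) (Fin n) ℝ}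
    (hl : l ≤ 1) (hκ : 0 ≤ κ) (hu₀ : u₀ ⬝ᵥ u₀ = 1) (hg₁ : g₁ ∈ networks n w)
    (heig : (1 - φ • g₁) *ᵥ u₀ = (1 - l) • u₀)
    {x : Fin n → ℝ} {g : Matrix (Fin n) (Fin n) ℝ} (ho : IsActionOptimal φ w κ a₀ g₀ C x g) :
    euclNorm ((1 - φ • g) *ᵥ x) ≤ (1 - l) * euclNorm x +
      ((1 - l) + 2 * euclNorm a₀ + √(κ * ∑ i, ∑ j, (g₁ i j - g₀ i j) ^ 2)) := by
  have hu1 : euclNorm u₀ = 1 := by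
    have := euclNorm_sq u₀
    nlinarith [euclNorm_nonneg u₀]
  set r := euclNorm x
  have hr : 0 ≤ r := euclNorm_nonneg x
  set D := κ * ∑ i, ∑ j, (g₁ i j - g₀ i j) ^ 2
  have hD : 0 ≤ D := by positivity
  have hα := euclNorm_nonneg a₀
  -- The profile `(r + 1) • u₀` beats `x`, so it is unaffordable; its cost bounds the budget, and
  -- thereby the residual of `x`.
  have hlt : C < actionCost φ κ a₀ g₀ ((r + 1) • u₀) g₁ := by
    by_contra! hle
    have := ho.2 _ _ hg₁ hle
    rw [← euclNorm_sq, ← euclNorm_sq, euclNorm_smul, hu1, abs_of_pos (by linarith)] at this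
    change _ ≤ r ^ 2 at this
    nlinarith
  have hcost : actionCost φ κ a₀ g₀ ((r + 1) • u₀) g₁ ≤
      (√D + ((1 - l) * (r + 1) + euclNorm a₀)) ^ 2 := by
    have h1 : euclNorm (((1 - φ • g₁) *ᵥ ((r + 1) • u₀)) - a₀) ≤
        (1 - l) * (r + 1) + euclNorm a₀ := by
      refine (euclNorm_sub_le _ _).trans ?_
      rw [mulVec_smul, heig, smul_smul, euclNorm_smul, hu1, abs_of_nonneg]
      · linarith
      · exact mul_nonneg (by linarith) (by linarith)
    have h2 := pow_le_pow_left₀ (euclNorm_nonneg _) h1 2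
    have h3 := Real.sq_sqrt hD
    have h4 : 0 ≤ √D * ((1 - l) * (r + 1) + euclNorm a₀) := by
      have : 0 ≤ (1 - l) * (r + 1) := mul_nonneg (by linarith) (by linarith)
      positivity
    unfold actionCost cost
    rw [sq_sum_eq_euclNorm]
    nlinarith
  have h5 : euclNorm ((1 - φ • g) *ᵥ x - a₀) ≤ √D + ((1 - l) * (r + 1) + euclNorm a₀) := by
    refine le_of_sq_le_sq ?_ ?_
    · exact (sq_euclNorm_le_actionCost hκ x g).trans (ho.1.2.trans (hlt.le.trans hcost))
    · have : 0 ≤ (1 - l) * (r + 1) := mul_nonneg (by linarith) (by linarith)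
      positivity
  have h6 := euclNorm_le_add ((1 - φ • g) *ᵥ x) a₀
  linarith

/-- Treats both signs of `φ` at once: if `T` has the sign of `p` and size at least `Z`, then `φ * T`
has the sign of `φ * p` and size at least `|φ| * Z`. -/
theorem mul_le_mul_of_sign {φ p T Z : ℝ} (hφ : φ ≠ 0) (hpos : 0 < p → Z ≤ T)
    (hneg : p < 0 → T ≤ -Z) :
    (0 < φ * p → |φ| * Z ≤ φ * T) ∧ (φ * p < 0 → φ * T ≤ -(|φ| * Z)) := by
  rcases lt_or_gt_of_ne hφ with h | h
  · rw [abs_of_neg h]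
    exact ⟨fun hp => by nlinarith [hneg (neg_of_mul_pos_right hp h.le)],
      fun hp => by nlinarith [hpos (pos_of_mul_neg_right hp h.le)]⟩
  · rw [abs_of_pos h]
    exact ⟨fun hp => by nlinarith [hpos (pos_of_mul_pos_right hp h.le)],
      fun hp => by nlinarith [hneg (neg_of_mul_neg_right hp h.le)]⟩

/-- The marginal adjustment cost is at most `2 * κ * w` in absolute value, while the residual term
grows with `r`. In `hrε`, the summand `2 * euclNorm a₀` absorbs the contribution of `a₀`, and the `+
1` makes the first-order inequalities strict. -/
theorem IsActionOptimal.link_eq_of_residual_bound (hκ : 0 ≤ κ) (hφ : φ ≠ 0)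
    (hg₀ : g₀ ∈ networks n w) {ε : ℝ} {x u : Fin n → ℝ}
    {g : Matrix (Fin n) (Fin n) ℝ} (ho : IsActionOptimal φ w κ a₀ g₀ C x g)
    {r : ℝ} (hr : 1 ≤ r) (hxu : x = r • u) (hu : u ⬝ᵥ u = 1)
    (hrε : 2 * euclNorm a₀ + (2 * κ * w + 1) / |φ| ≤ r * ε) {i j : Fin n} (hij : i ≠ j)
    (hε : ε ≤ (((1 - φ • g) *ᵥ u) i * u j + ((1 - φ • g) *ᵥ u) j * u i) * (u i * u j)) :
    (0 < φ * (x i * x j) → g i j = w) ∧ (φ * (x i * x j) < 0 → g i j = 0) := by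
  have hu1 : euclNorm u = 1 := by
    have := euclNorm_sq u
    nlinarith [euclNorm_nonneg u]
  have hx : x ≠ 0 := by
    rintro rfl
    have : u = 0 := (smul_eq_zero.mp hxu.symm).resolve_left (by linarith)
    simp [this] at hu
  have hui : |u i| ≤ 1 := hu1 ▸ abs_apply_le_euclNorm u i
  have huj : |u j| ≤ 1 := hu1 ▸ abs_apply_le_euclNorm u j
  set α := euclNorm a₀
  have hα : 0 ≤ α := euclNorm_nonneg _
  have hai : |a₀ i| ≤ α := abs_apply_le_euclNorm a₀ i
  have haj : |a₀ j| ≤ α := abs_apply_le_euclNorm a₀ j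
  set y := (1 - φ • g) *ᵥ u
  set S := y i * u j + y j * u i
  have hw : 0 ≤ w := (ho.1.1.1 i j).2.1.trans (ho.1.1.1 i j).2.2
  have hφ' : 0 < |φ| := abs_pos.mpr hφ
  have hprod : |u i * u j| ≤ 1 := by rw [abs_mul]; exact mul_le_one₀ hui (abs_nonneg _) huj
  have hε0 : 0 < ε := by
    have : 0 < 2 * α + (2 * κ * w + 1) / |φ| := by positivity
    exact pos_of_mul_pos_right (this.trans_le hrε) (by linarith)
  have hT : x j * ((1 - φ • g) *ᵥ x - a₀ : Fin n → ℝ) i +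
      x i * ((1 - φ • g) *ᵥ x - a₀ : Fin n → ℝ) j =
      r * (r * S - (u j * a₀ i + u i * a₀ j)) := by
    simp only [hxu, mulVec_smul, Pi.sub_apply, Pi.smul_apply, smul_eq_mul, S, y]
    ring
  obtain ⟨fo1, fo2⟩ := ho.first_order hg₀ hx hκ hij rfl
  rw [hT] at fo1 fo2
  have hbd : |u j * a₀ i + u i * a₀ j| ≤ 2 * α := by
    refine (abs_add_le _ _).trans ?_
    rw [abs_mul, abs_mul]
    have h1 := mul_le_mul huj hai (abs_nonneg _) zero_le_one
    have h2 := mul_le_mul hui haj (abs_nonneg _) zero_le_one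
    linarith
  obtain ⟨hb1, hb2⟩ := abs_le.mp hbd
  obtain ⟨hp1, hp2⟩ := abs_le.mp hprod
  set Z := (2 * κ * w + 1) / |φ| with hZ
  have hZ0 : 0 < Z := by positivity
  have hZφ : |φ| * Z = 2 * κ * w + 1 := by rw [hZ]; field_simp
  have hpos : 0 < u i * u j → Z ≤ r * (r * S - (u j * a₀ i + u i * a₀ j)) := by
    intro hp
    have hS0 : 0 < S := pos_of_mul_pos_left (hε0.trans_le hε) hp.le
    have hS : ε ≤ S := by nlinarith
    have : Z ≤ r * S - (u j * a₀ i + u i * a₀ j) := by nlinarith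
    nlinarith
  have hneg : u i * u j < 0 → r * (r * S - (u j * a₀ i + u i * a₀ j)) ≤ -Z := by
    intro hp
    have hS0 : S < 0 := by
      by_contra! hc
      nlinarith
    have hS : S ≤ -ε := by nlinarith
    have : r * S - (u j * a₀ i + u i * a₀ j) ≤ -Z := by nlinarith
    nlinarith
  set T := r * (r * S - (u j * a₀ i + u i * a₀ j))
  have hcw := (ho.1.1.1 i j).2
  have hcw₀ := (hg₀.1 i j).2
  have hk1 : 2 * κ * (g i j - g₀ i j) ≤ 2 * κ * w := by
    have := hcw.2; have := hcw₀.1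
    gcongr; linarith
  have hk2 : -(2 * κ * w) ≤ 2 * κ * (g i j - g₀ i j) := by
    have := hcw.1; have := hcw₀.2
    nlinarith
  have hxx : φ * (x i * x j) = r ^ 2 * (φ * (u i * u j)) := by simp [hxu]; ring
  have hr2 : 0 < r ^ 2 := by positivity
  obtain ⟨hs1, hs2⟩ := mul_le_mul_of_sign hφ hpos hneg
  rw [hZφ] at hs1 hs2
  rw [hxx]
  refine ⟨fun hp => fo1 ?_, fun hp => fo2 ?_⟩
  · linarith [hs1 (pos_of_mul_pos_right hp hr2.le)]
  · linarith [hs2 (neg_of_mul_neg_right hp hr2.le)]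

/-- Optimal networks for large budgets: if the largest quadratic form of a network is attained by
`u₀`, and only vectors with property `Q` come close, then the optimal network is determined by
the signs of a vector with property `Q`. -/
theorem exists_budget_forall_isOptimal (hκ : 0 ≤ κ) (hφ : φ ≠ 0) (hg₀ : g₀ ∈ networks n w)
    (hl : l < 1) (hl' : l' < l) {Q : (Fin n → ℝ) → Prop} (hQ : ∀ x, Q x → ∀ i, x i ≠ 0)
    (hgap : ∀ g ∈ networks n w, ∀ x : Fin n → ℝ, Q x ∨ φ * (x ⬝ᵥ g *ᵥ x) ≤ l' * (x ⬝ᵥ x))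
    (h : FormBound n φ w l) {u₀ : Fin n → ℝ} {g₁ : Matrix (Fin n) (Fin n) ℝ} (hu₀ : u₀ ≠ 0)
    (hg₁ : g₁ ∈ networks n w) (heig : φ • (g₁ *ᵥ u₀) = l • u₀) :
    ∃ Cbar : ℝ, ∀ C : ℝ, Cbar < C → ∀ a g, IsOptimal φ w κ a₀ g₀ C a g →
      ∃ x, Q x ∧ ∀ i j, i ≠ j →
        (0 < φ * (x i * x j) → g i j = w) ∧ (φ * (x i * x j) < 0 → g i j = 0) := by
  wlog hn : u₀ ⬝ᵥ u₀ = 1 generalizing u₀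
  · have h0 := euclNorm_pos hu₀
    refine this (u₀ := (euclNorm u₀)⁻¹ • u₀) (smul_ne_zero (inv_ne_zero h0.ne') hu₀) ?_ ?_
    · rw [mulVec_smul, smul_comm, heig, smul_comm]
    · rw [← euclNorm_sq, euclNorm_smul, abs_of_pos (inv_pos.mpr h0), inv_mul_cancel₀ h0.ne',
        one_pow]
  have heig' : (1 - φ • g₁) *ᵥ u₀ = (1 - l) • u₀ := by
    rw [sub_mulVec, one_mulVec, smul_mulVec, heig, sub_smul, one_smul]
  obtain ⟨ε, hε, hres⟩ := exists_residual_bound hl hl' hQ hgap h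
  set B := (1 - l) + 2 * euclNorm a₀ + √(κ * ∑ i, ∑ j, (g₁ i j - g₀ i j) ^ 2)
  set Z := 2 * euclNorm a₀ + (2 * κ * w + 1) / |φ|
  -- The bounds on `R` serve, in turn, to scale safely, to bring the normalized residual within `ε`
  -- of `1 - l`, to force `Q x`, and to make the residual term dominate in the first-order
  -- conditions.
  obtain ⟨R, hR1, hRε, hRl, hRZ⟩ : ∃ R : ℝ, 1 ≤ R ∧ B / ε ≤ R ∧ (B + 1) / (l - l') ≤ R ∧
      Z / ε ≤ R := by
    refine ⟨max (max 1 (B / ε)) (max ((B + 1) / (l - l')) (Z / ε)), ?_, ?_, ?_, ?_⟩ <;> simp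
  -- Above this budget `R • u₀` is affordable, so an optimal `x` has norm at least `R`.
  refine ⟨actionCost φ κ a₀ g₀ (R • u₀) g₁, fun C hC a g hopt => ?_⟩
  obtain ⟨x, ho⟩ := hopt.exists_isActionOptimal h hl
  have hg := ho.1.1
  set r := euclNorm x with hr
  have hrR : R ≤ r := by
    have h1 := ho.2 _ _ hg₁ hC.le
    rw [smul_dotProduct, dotProduct_smul, hn, ← euclNorm_sq x] at h1
    simp only [smul_eq_mul, mul_one] at h1
    exact abs_le_of_sq_le_sq' (by rw [pow_two]; exact h1) (euclNorm_nonneg x) |>.2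
  have hr0 : 0 < r := by linarith
  have hxu : x = r • (r⁻¹ • x) := by rw [smul_smul, mul_inv_cancel₀ hr0.ne', one_smul]
  have hu : (r⁻¹ • x) ⬝ᵥ (r⁻¹ • x) = 1 := by
    rw [← euclNorm_sq, euclNorm_smul, abs_of_pos (inv_pos.mpr hr0), inv_mul_cancel₀ hr0.ne',
      one_pow]
  have hres_le := ho.residual_le hl.le hκ hn hg₁ heig'
  change euclNorm ((1 - φ • g) *ᵥ x) ≤ (1 - l) * r + B at hres_le
  have hBε : B ≤ r * ε := by
    rw [div_le_iff₀ hε] at hRε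
    nlinarith
  have hZε : Z ≤ r * ε := by
    rw [div_le_iff₀ hε] at hRZ
    nlinarith
  have hnear : euclNorm ((1 - φ • g) *ᵥ (r⁻¹ • x)) ≤ 1 - l + ε := by
    rw [mulVec_smul, euclNorm_smul, abs_of_pos (inv_pos.mpr hr0), inv_mul_le_iff₀ hr0]
    linarith
  refine ⟨x, ?_, fun i j hij => ho.link_eq_of_residual_bound hκ hφ hg₀ (hR1.trans hrR) hxu hu
    hZε hij (hres g hg _ hu hnear i j)⟩
  -- Without `Q x` the residual would be at least `(1 - l') * r`, which exceeds `(1 - l) * r + B`.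
  refine (hgap g hg x).resolve_right fun hcon => ?_
  have h1 := sub_mul_euclNorm_le hcon
  have h2 : B + 1 ≤ (l - l') * r := by
    rw [div_le_iff₀ (by linarith)] at hRl
    nlinarith
  linarith

end NetworkIntervention

namespace NetworkIntervention
open Matrix

/-! ### Quadratic forms of networks bounded by sign counts. -/

section SignCounts
variable {n : ℕ} {w : ℝ}

/-- The number of positive entries of a vector. -/
noncomputable def numPos (u : Fin n → ℝ) : ℕ := (Finset.univ.filter fun i => 0 < u i).card

/-- Cauchy-Schwarz on the support of the positive part, which is how sign counts enter the bounds.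
-/
theorem sq_sum_posPart_le (u : Fin n → ℝ) :
    (∑ i, max (u i) 0) ^ 2 ≤ numPos u * ∑ i, max (u i) 0 ^ 2 := by
  have h1 : ∀ i ∈ Finset.univ, i ∉ Finset.univ.filter (fun i => 0 < u i) → max (u i) 0 = 0 := by
    intro i _ hi
    simpa using hi
  rw [← Finset.sum_subset (Finset.filter_subset (fun i => 0 < u i) Finset.univ) h1,
    ← Finset.sum_subset (Finset.filter_subset (fun i => 0 < u i) Finset.univ)
      (fun i hi hi' => by rw [h1 i hi hi']; simp)]
  exact sq_sum_le_card_mul_sum_sq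

theorem max_sub_max_neg (t : ℝ) : max t 0 - max (-t) 0 = t := by
  rcases le_total t 0 with h | h
  · rw [max_eq_right h, max_eq_left (by linarith)]; ring
  · rw [max_eq_left h, max_eq_right (by linarith)]; ring

theorem dotProduct_self_eq_posPart (u : Fin n → ℝ) :
    u ⬝ᵥ u = ∑ i, max (u i) 0 ^ 2 + ∑ i, max ((-u) i) 0 ^ 2 := by
  rw [← Finset.sum_add_distrib]
  refine Finset.sum_congr rfl fun i _ => ?_
  rcases le_total (u i) 0 with h | h
  · rw [max_eq_right h, Pi.neg_apply, max_eq_left (by linarith)]; ring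
  · rw [max_eq_left h, Pi.neg_apply, max_eq_right (by linarith)]; ring

theorem numPos_add_numPos_neg (u : Fin n → ℝ) :
    numPos u + numPos (-u) + (Finset.univ.filter fun i => u i = 0).card = n := by
  have h : ∀ i : Fin n, (if 0 < u i then 1 else 0) + (if 0 < (-u) i then 1 else 0) +
      (if u i = 0 then 1 else 0) = 1 := by
    intro i
    rcases lt_trichotomy (u i) 0 with h | h | h
    · simp [h, h.ne, h.not_gt]
    · simp [h]
    · simp [h, h.ne', h.not_gt]
  simp only [numPos, Finset.card_filter, ← Finset.sum_add_distrib, h]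
  simp

theorem numPos_le (u : Fin n → ℝ) : numPos u ≤ n := by
  have := numPos_add_numPos_neg u
  omega

theorem numPos_lt {u : Fin n → ℝ} {k : Fin n} (hk : u k ≤ 0) : numPos u < n := by
  have : (Finset.univ.filter fun i => 0 < u i).card < (Finset.univ : Finset (Fin n)).card :=
    Finset.card_lt_card (Finset.filter_ssubset.mpr ⟨k, Finset.mem_univ k, hk.not_gt⟩)
  simpa [numPos] using this

theorem dotProduct_mulVec_eq_sum (u : Fin n → ℝ) (g : Matrix (Fin n) (Fin n) ℝ) :
    u ⬝ᵥ g *ᵥ u = ∑ i, ∑ j, g i j * (u i * u j) := by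
  simp only [dotProduct, mulVec, Finset.mul_sum]
  exact Finset.sum_congr rfl fun i _ => Finset.sum_congr rfl fun j _ => by ring

theorem mul_eq_posPart (s t : ℝ) : s * t = max s 0 * max t 0 + max (-s) 0 * max (-t) 0 -
    (max s 0 * max (-t) 0 + max (-s) 0 * max t 0) := by
  conv_lhs => rw [← max_sub_max_neg s, ← max_sub_max_neg t]
  ring

/-- Drop the pairs of opposite sign and raise the other weights to `w`: this leaves `w((∑u⁺)² +
(∑u⁻)² - |u|²)`, and Cauchy-Schwarz bounds each square by `k` times a sum of squares. The missing
diagonal gives the `-1`. -/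
theorem dotProduct_mulVec_le_of_numPos_le {g : Matrix (Fin n) (Fin n) ℝ} (hg : g ∈ networks n w)
    (hw : 0 ≤ w) {u : Fin n → ℝ} {k : ℝ} (hp : numPos u ≤ k) (hq : numPos (-u) ≤ k) :
    u ⬝ᵥ g *ᵥ u ≤ w * (k - 1) * (u ⬝ᵥ u) := by
  have hterm : ∀ i j, g i j * (u i * u j) ≤ w * (max (u i) 0 * max (u j) 0) +
      w * (max ((-u) i) 0 * max ((-u) j) 0) -
      if i = j then w * (max (u i) 0 ^ 2 + max ((-u) i) 0 ^ 2) else 0 := by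
    intro i j
    split_ifs with hij
    · subst hij
      rw [hg.2]
      exact le_of_eq (by ring)
    · have h1 := mul_eq_posPart (u i) (u j)
      have h2 : 0 ≤ max (u i) 0 * max (-(u j)) 0 + max (-(u i)) 0 * max (u j) 0 := by positivity
      have h3 : 0 ≤ max (u i) 0 * max (u j) 0 + max (-(u i)) 0 * max (-(u j)) 0 := by positivity
      have h4 := (hg.1 i j).2
      simp only [Pi.neg_apply]
      calc g i j * (u i * u j)
          ≤ g i j * (max (u i) 0 * max (u j) 0 + max (-(u i)) 0 * max (-(u j)) 0) :=
            mul_le_mul_of_nonneg_left (by linarith) h4.1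
        _ ≤ w * (max (u i) 0 * max (u j) 0 + max (-(u i)) 0 * max (-(u j)) 0) :=
            mul_le_mul_of_nonneg_right h4.2 h3
        _ = _ := by ring
  have hsum : u ⬝ᵥ g *ᵥ u ≤ w * ((∑ i, max (u i) 0) ^ 2 + (∑ i, max ((-u) i) 0) ^ 2 - u ⬝ᵥ u) := by
    rw [dotProduct_mulVec_eq_sum]
    refine (Finset.sum_le_sum fun i _ => Finset.sum_le_sum fun j _ => hterm i j).trans_eq ?_
    simp only [Finset.sum_add_distrib, Finset.sum_sub_distrib, ← Finset.mul_sum,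
      Finset.sum_ite_eq, Finset.mem_univ, if_true, dotProduct_self_eq_posPart u, pow_two,
      Finset.sum_mul]
    ring
  have h1 := sq_sum_posPart_le u
  have h2 := sq_sum_posPart_le (-u)
  have hA : 0 ≤ ∑ i, max (u i) 0 ^ 2 := by positivity
  have hB : 0 ≤ ∑ i, max ((-u) i) 0 ^ 2 := by positivity
  refine hsum.trans ?_
  rw [mul_assoc]
  refine mul_le_mul_of_nonneg_left ?_ hw
  have h3 := mul_le_mul_of_nonneg_right hp hA
  have h4 := mul_le_mul_of_nonneg_right hq hB
  rw [dotProduct_self_eq_posPart u]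
  linarith

/-- Only pairs of opposite sign help, giving `2w(∑u⁺)(∑u⁻)`. Cauchy-Schwarz on each factor and the
arithmetic-geometric mean inequality for `|u⁺|²` and `|u⁻|²` finish the bound. -/
theorem neg_dotProduct_mulVec_le {g : Matrix (Fin n) (Fin n) ℝ} (hg : g ∈ networks n w)
    (hw : 0 ≤ w) {u : Fin n → ℝ} {k : ℝ} (hk : (numPos u : ℝ) * numPos (-u) ≤ k) :
    -(u ⬝ᵥ g *ᵥ u) ≤ w * √k * (u ⬝ᵥ u) := by
  have hterm : ∀ i j, -(g i j * (u i * u j)) ≤ w * (max (u i) 0 * max ((-u) j) 0) +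
      w * (max ((-u) i) 0 * max (u j) 0) := by
    intro i j
    have h1 := mul_eq_posPart (u i) (u j)
    have h2 : 0 ≤ max (u i) 0 * max (-(u j)) 0 + max (-(u i)) 0 * max (u j) 0 := by positivity
    have h3 : 0 ≤ max (u i) 0 * max (u j) 0 + max (-(u i)) 0 * max (-(u j)) 0 := by positivity
    have h4 := (hg.1 i j).2
    simp only [Pi.neg_apply]
    calc -(g i j * (u i * u j)) = g i j * -(u i * u j) := by ring
      _ ≤ g i j * (max (u i) 0 * max (-(u j)) 0 + max (-(u i)) 0 * max (u j) 0) :=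
          mul_le_mul_of_nonneg_left (by linarith) h4.1
      _ ≤ w * (max (u i) 0 * max (-(u j)) 0 + max (-(u i)) 0 * max (u j) 0) :=
          mul_le_mul_of_nonneg_right h4.2 h2
      _ = _ := by ring
  have hsum : -(u ⬝ᵥ g *ᵥ u) ≤ w * (2 * ((∑ i, max (u i) 0) * ∑ i, max ((-u) i) 0)) := by
    rw [dotProduct_mulVec_eq_sum]
    simp only [← Finset.sum_neg_distrib]
    refine (Finset.sum_le_sum fun i _ => Finset.sum_le_sum fun j _ => hterm i j).trans_eq ?_
    simp only [Finset.sum_add_distrib, ← Finset.mul_sum, ← Finset.sum_mul]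
    ring
  refine hsum.trans ?_
  rw [mul_assoc]
  refine mul_le_mul_of_nonneg_left ?_ hw
  have h1 := sq_sum_posPart_le u
  have h2 := sq_sum_posPart_le (-u)
  rw [dotProduct_self_eq_posPart u]
  set s := ∑ i, max (u i) 0
  set t := ∑ i, max ((-u) i) 0
  set A := ∑ i, max (u i) 0 ^ 2
  set B := ∑ i, max ((-u) i) 0 ^ 2
  have hA : 0 ≤ A := by positivity
  have hB : 0 ≤ B := by positivity
  have hk0 : 0 ≤ k := le_trans (by positivity) hk
  have h5 : (2 * (s * t)) ^ 2 ≤ (√k * (A + B)) ^ 2 := by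
    rw [mul_pow √k, Real.sq_sqrt hk0]
    calc (2 * (s * t)) ^ 2 = 4 * (s ^ 2 * t ^ 2) := by ring
      _ ≤ 4 * ((numPos u * A) * (numPos (-u) * B)) := by gcongr
      _ = (numPos u * numPos (-u)) * (4 * (A * B)) := by ring
      _ ≤ k * (4 * (A * B)) := by gcongr
      _ ≤ k * (A + B) ^ 2 := by gcongr; nlinarith [sq_nonneg (A - B)]
  exact le_of_sq_le_sq h5 (by positivity)

end SignCounts

/-- Products of two numbers with sum at most `n` are maximal for balanced pairs only. -/
theorem mul_lt_or_balanced {n p q : ℕ} (hn : 2 ≤ n) (h : p + q ≤ n) :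
    p * q + 1 ≤ n / 2 * ((n + 1) / 2) ∨ (p = n / 2 ∧ q = (n + 1) / 2) ∨
      (p = (n + 1) / 2 ∧ q = n / 2) := by
  by_contra! hcon
  obtain ⟨h1, h2, h3⟩ := hcon
  -- Since `4pq = (p + q)² - d²`, a product at least the balanced one forces `d = 0` for even `n`
  -- and `d² ≤ 1` for odd `n`.
  obtain ⟨d, hd⟩ : ∃ d : ℤ, (p : ℤ) = q + d := ⟨p - q, by ring⟩
  rcases Nat.even_or_odd' n with ⟨k, rfl | rfl⟩
  · have e1 : 2 * k / 2 = k := by omega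
    have e2 : (2 * k + 1) / 2 = k := by omega
    rw [e1, e2] at h1 h2 h3
    have h1' : k * k ≤ p * q := by omega
    zify at h1' h
    have hd0 : d = 0 := by
      rw [hd] at h1' h
      nlinarith [sq_nonneg d]
    have hqk : (k : ℤ) ≤ q := by
      rw [hd, hd0] at h1'
      nlinarith
    omega
  · have e1 : (2 * k + 1) / 2 = k := by omega
    have e2 : (2 * k + 1 + 1) / 2 = k + 1 := by omega
    rw [e1, e2] at h1 h2 h3
    have h1' : k * (k + 1) ≤ p * q := by omega
    zify at h1' h
    have hd1 : d ^ 2 ≤ 1 := by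
      rw [hd] at h1' h
      nlinarith
    have hd2 : -1 ≤ d := by nlinarith
    have hd3 : d ≤ 1 := by nlinarith
    have hqk : (k : ℤ) ≤ q := by
      by_contra! hlt
      have : (p : ℤ) * q ≤ k * q := by
        refine mul_le_mul_of_nonneg_right (by omega) (by positivity)
      nlinarith
    have hpk : (k : ℤ) ≤ p := by
      by_contra! hlt
      have : (p : ℤ) * q ≤ p * k := by
        refine mul_le_mul_of_nonneg_left (by omega) (by positivity)
      nlinarith
    interval_cases d
    · omega
    · have : (q : ℤ) = k := by omega
      rw [hd, this] at h1'
      nlinarith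
    · omega

/-! ### The complete and the complete bipartite case. -/

section Cases
variable {n : ℕ} {φ w κ : ℝ} {a₀ : Fin n → ℝ} {g₀ : Matrix (Fin n) (Fin n) ℝ}

theorem exists_isOptimal {C l : ℝ} (hκ : 0 ≤ κ) (hg₀ : g₀ ∈ networks n w)
    (h : FormBound n φ w l) (hl : l < 1) (hC : 0 ≤ C) : ∃ a g, IsOptimal φ w κ a₀ g₀ C a g := by
  obtain ⟨x, g, hx⟩ := exists_isActionOptimal (a₀ := a₀) hκ hg₀ h hl hC
  exact ⟨_, g, (isOptimal_mulVec_iff h hl x).mpr hx⟩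

theorem networks_eq_zero (h : n ≤ 1 ∨ w = 0) {g : Matrix (Fin n) (Fin n) ℝ}
    (hg : g ∈ networks n w) : g = 0 := by
  ext i j
  rcases h with h | rfl
  · obtain rfl : i = j := Fin.ext (by omega)
    exact hg.2 i
  · exact le_antisymm (hg.1 i j).2.2 (hg.1 i j).2.1

theorem formBound_zero (h : n ≤ 1 ∨ w = 0) : FormBound n φ w 0 := by
  intro g hg x
  simp [networks_eq_zero h hg]

theorem smul_completeNetwork_mem (hw : 0 ≤ w) : w • completeNetwork n ∈ networks n w := by
  have he : ∀ i j, (w • completeNetwork n) i j = if i = j then 0 else w := by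
    intro i j
    by_cases hij : i = j <;> simp [completeNetwork, one_apply, hij]
  refine ⟨fun i j => ⟨?_, ?_⟩, fun k => ?_⟩
  · simp only [he, eq_comm]
  · rw [he]; split_ifs <;> simp [hw]
  · simp [he]

theorem smul_completeNetwork_mulVec_one :
    (w • completeNetwork n) *ᵥ (fun _ => (1 : ℝ)) = (w * ((n : ℝ) - 1)) • fun _ => (1 : ℝ) := by
  ext i
  simp [completeNetwork, mulVec, dotProduct, one_apply, ← Finset.mul_sum]

/-- Here `l = φw(n - 1)`, with the constant eigenvector of the complete network. A vector not
strictly of one sign has at most `n - 1` positive and at most `n - 1` negative entries, whence `l' =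
φw(n - 2)`. -/
theorem exists_budget_complete (hκ : 0 ≤ κ) (hφ : 0 < φ) (hw : 0 < w) (hn : 2 ≤ n)
    (hg₀ : g₀ ∈ networks n w) (hb : w < 1 / (φ * ((n : ℝ) - 1))) :
    ∃ Cbar : ℝ, ∀ C : ℝ, Cbar < C →
      (∃ a g, IsOptimal φ w κ a₀ g₀ C a g) ∧
      ∀ a g, IsOptimal φ w κ a₀ g₀ C a g → g = w • completeNetwork n := by
  have hn' : (2 : ℝ) ≤ n := by exact_mod_cast hn
  have hl : φ * (w * ((n : ℝ) - 1)) < 1 := by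
    rw [lt_div_iff₀ (mul_pos hφ (by linarith))] at hb
    linarith
  have hl' : φ * (w * ((n : ℝ) - 1 - 1)) < φ * (w * ((n : ℝ) - 1)) := by
    have : 0 < φ * w := mul_pos hφ hw
    linarith
  have hform : FormBound n φ w (φ * (w * ((n : ℝ) - 1))) := by
    intro g hg x
    have := dotProduct_mulVec_le_of_numPos_le hg hw.le (u := x) (k := n)
      (by exact_mod_cast numPos_le x) (by exact_mod_cast numPos_le (-x))
    rw [mul_assoc φ]
    exact mul_le_mul_of_nonneg_left this hφ.le
  have hgap : ∀ g ∈ networks n w, ∀ x : Fin n → ℝ, ((∀ i, 0 < x i) ∨ ∀ i, x i < 0) ∨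
      φ * (x ⬝ᵥ g *ᵥ x) ≤ φ * (w * ((n : ℝ) - 1 - 1)) * (x ⬝ᵥ x) := by
    intro g hg x
    refine or_iff_not_imp_left.mpr fun hQ => ?_
    push Not at hQ
    obtain ⟨⟨i, hi⟩, j, hj⟩ := hQ
    have h1 : ((numPos x + 1 : ℕ) : ℝ) ≤ n := by exact_mod_cast numPos_lt hi
    have h2 : ((numPos (-x) + 1 : ℕ) : ℝ) ≤ n := by
      exact_mod_cast numPos_lt (u := -x) (k := j) (by simpa using hj)
    push_cast at h1 h2
    have := dotProduct_mulVec_le_of_numPos_le hg hw.le (u := x) (k := (n : ℝ) - 1)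
      (by linarith) (by linarith)
    rw [mul_assoc φ]
    exact mul_le_mul_of_nonneg_left this hφ.le
  obtain ⟨Cbar, hC⟩ := exists_budget_forall_isOptimal (a₀ := a₀) hκ hφ.ne' hg₀ hl hl'
    (fun x hx i => by rcases hx with h | h <;> [exact (h i).ne'; exact (h i).ne]) hgap hform
    (u₀ := fun _ => 1) (fun h => by simpa using congrFun h ⟨0, by omega⟩)
    (smul_completeNetwork_mem hw.le)
    (by rw [smul_completeNetwork_mulVec_one, smul_smul])
  -- Existence needs `0 ≤ C`, so that the status quo is feasible.
  refine ⟨max Cbar 0, fun C hlt => ⟨exists_isOptimal hκ hg₀ hform hl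
    ((le_max_right _ _).trans hlt.le), fun a g ho => ?_⟩⟩
  obtain ⟨x, hx, hlink⟩ := hC C ((le_max_left _ _).trans_lt hlt) a g ho
  ext i j
  by_cases hij : i = j
  · subst hij
    have : g i i = 0 := ho.1.1.2 i
    simp [completeNetwork, this]
  · rw [(hlink i j hij).1 (mul_pos hφ ?_)]
    · simp [completeNetwork, one_apply, hij]
    · rcases hx with h | h
      · exact mul_pos (h i) (h j)
      · exact mul_pos_of_neg_of_neg (h i) (h j)

theorem completeBipartiteNetwork_apply {p q : ℕ} (s t : Fin p ⊕ Fin q) :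
    completeBipartiteNetwork p q s t = if s.isLeft = t.isLeft then 0 else 1 := by
  rcases s with s | s <;> rcases t with t | t <;> simp [completeBipartiteNetwork]

/-- A network that links exactly the players with entries of opposite sign is complete
bipartite. -/
theorem networkIso_of_opposite_sign {x : Fin n → ℝ} (hx : ∀ i, x i ≠ 0)
    {g : Matrix (Fin n) (Fin n) ℝ} (hd : ∀ i, g i i = 0)
    (hneg : ∀ i j, x i * x j < 0 → g i j = w) (hpos : ∀ i j, i ≠ j → 0 < x i * x j → g i j = 0)
    {p q : ℕ} (hp : numPos x = p) (hq : numPos (-x) = q) :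
    NetworkIso g (w • completeBipartiteNetwork p q) := by
  have hp' : Fintype.card {i // 0 < x i} = p := by rw [Fintype.card_subtype]; exact hp
  have hq' : Fintype.card {i // ¬0 < x i} = q := by
    rw [Fintype.card_subtype, ← hq, numPos]
    congr 1
    ext i
    simpa using ⟨fun h => lt_of_le_of_ne h (hx i), le_of_lt⟩
  let σ : Fin n ≃ Fin p ⊕ Fin q := (Equiv.sumCompl fun i => 0 < x i).symm.trans
    (Equiv.sumCongr (Fintype.equivFinOfCardEq hp') (Fintype.equivFinOfCardEq hq'))
  have hσ : ∀ i, (σ i).isLeft = true ↔ 0 < x i := by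
    intro i
    by_cases h : 0 < x i
    · simp [σ, h]
    · simp [σ, h]
  refine ⟨σ, fun i j => ?_⟩
  simp only [Matrix.smul_apply, completeBipartiteNetwork_apply, Bool.eq_iff_iff, hσ]
  by_cases hij : i = j
  · subst hij; simp [hd]
  rcases lt_or_gt_of_ne (hx i) with hi | hi <;> rcases lt_or_gt_of_ne (hx j) with hj | hj
  · simp [hpos i j hij (mul_pos_of_neg_of_neg hi hj), hi.not_gt, hj.not_gt]
  · simp [hneg i j (mul_neg_of_neg_of_pos hi hj), hi.not_gt, hj]
  · simp [hneg i j (mul_neg_of_pos_of_neg hi hj), hi, hj.not_gt]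
  · simp [hpos i j hij (mul_pos hi hj), hi, hj]

theorem sum_ite_val_lt {p q : ℕ} (h : p + q = n) (A B : ℝ) :
    ∑ j : Fin n, (if j.val < p then A else B) = p * A + q * B := by
  subst h
  simp [Fin.sum_univ_add]

/-- The complete bipartite network between the first `p` players and the others. -/
def initialBipartite (n p : ℕ) (w : ℝ) : Matrix (Fin n) (Fin n) ℝ :=
  Matrix.of fun i j => if (i.val < p ↔ j.val < p) then 0 else w

theorem initialBipartite_mem (n p : ℕ) (hw : 0 ≤ w) : initialBipartite n p w ∈ networks n w := by
  refine ⟨fun i j => ⟨?_, ?_⟩, fun k => ?_⟩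
  · simp only [initialBipartite, of_apply, iff_comm]
  · simp only [initialBipartite, of_apply]; split_ifs <;> simp [hw]
  · simp [initialBipartite]

/-- The eigenvector for the least eigenvalue of a complete bipartite graph; the entries `√q` and
`-√p` balance the two parts. -/
theorem initialBipartite_mulVec {p q : ℕ} (h : p + q = n) :
    initialBipartite n p w *ᵥ (fun i => if i.val < p then √(q : ℝ) else -√(p : ℝ)) =
      (-(w * √((p : ℝ) * q))) • fun i : Fin n => if i.val < p then √(q : ℝ) else -√(p : ℝ) := by
  have hp : √(p : ℝ) * √(p : ℝ) = p := Real.mul_self_sqrt (by positivity)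
  have hq : √(q : ℝ) * √(q : ℝ) = q := Real.mul_self_sqrt (by positivity)
  ext i
  rw [Real.sqrt_mul (by positivity), Pi.smul_apply, smul_eq_mul]
  simp only [initialBipartite, mulVec, dotProduct, of_apply]
  by_cases hi : i.val < p
  · rw [if_pos hi]
    have : ∀ j : Fin n, (if (i.val < p ↔ j.val < p) then 0 else w) *
        (if j.val < p then √(q : ℝ) else -√(p : ℝ)) = if j.val < p then 0 else -(w * √(p : ℝ)) := by
      intro j
      by_cases hj : j.val < p <;> simp [hi, hj]
    rw [Finset.sum_congr rfl fun j _ => this j, sum_ite_val_lt h]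
    linear_combination (w * √(p : ℝ)) * hq
  · rw [if_neg hi]
    have : ∀ j : Fin n, (if (i.val < p ↔ j.val < p) then 0 else w) *
        (if j.val < p then √(q : ℝ) else -√(p : ℝ)) = if j.val < p then w * √(q : ℝ) else 0 := by
      intro j
      by_cases hj : j.val < p <;> simp [hi, hj]
    rw [Finset.sum_congr rfl fun j _ => this j, sum_ite_val_lt h]
    linear_combination -(w * √(q : ℝ)) * hp

/-- The product `⌊n/2⌋⌈n/2⌉` is `n²/4` or `(n² - 1)/4`, so both parity bounds say that `-φ` times
the spectral radius is below `1`. -/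
theorem bipartite_radius_lt_one (hφ : φ < 0) (hn : 2 ≤ n)
    (he : Even n → w < -(2 / (φ * n))) (ho : Odd n → w < -(2 / (φ * √((n : ℝ) ^ 2 - 1)))) :
    -φ * (w * √(((n / 2 : ℕ) : ℝ) * ((n + 1) / 2 : ℕ))) < 1 := by
  have key : ∀ s : ℝ, 0 < s → w < -(2 / (φ * (2 * s))) → -φ * (w * s) < 1 := by
    intro s hs h
    have h1 : -(2 / (φ * (2 * s))) = 1 / (-φ * s) := by
      field_simp
    rw [h1, lt_div_iff₀ (mul_pos (by linarith) hs)] at h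
    linarith
  rcases Nat.even_or_odd' n with ⟨k, rfl | rfl⟩
  · have e1 : 2 * k / 2 = k := by omega
    have e2 : (2 * k + 1) / 2 = k := by omega
    have hk : (0 : ℝ) < k := by exact_mod_cast (by omega : 0 < k)
    rw [e1, e2, Real.sqrt_mul_self hk.le]
    refine key k hk ?_
    simpa using he (even_two_mul k)
  · have e1 : (2 * k + 1) / 2 = k := by omega
    have e2 : (2 * k + 1 + 1) / 2 = k + 1 := by omega
    have hk : (0 : ℝ) < k := by exact_mod_cast (by omega : 0 < k)
    rw [e1, e2]
    refine key _ (by positivity) ?_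
    have h := ho (odd_two_mul_add_one k)
    have h4 : √(((2 * k + 1 : ℕ) : ℝ) ^ 2 - 1) = 2 * √((k : ℝ) * (k + 1 : ℕ)) := by
      rw [show ((2 * k + 1 : ℕ) : ℝ) ^ 2 - 1 = 2 ^ 2 * ((k : ℝ) * (k + 1 : ℕ)) by push_cast; ring,
        Real.sqrt_mul (by positivity), Real.sqrt_sq (by positivity)]
    rwa [h4] at h

/-- Here `l = -φw√(pq)` with balanced `p`, `q`. Sign counts are integers, so any other pattern has
product at most `pq - 1`, which gives `l'`. A balanced pattern uses up all `n` entries and so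
excludes zeros. -/
theorem exists_budget_bipartite (hκ : 0 ≤ κ) (hφ : φ < 0) (hw : 0 < w) (hn : 2 ≤ n)
    (hg₀ : g₀ ∈ networks n w)
    (he : Even n → w < -(2 / (φ * n))) (ho : Odd n → w < -(2 / (φ * √((n : ℝ) ^ 2 - 1)))) :
    ∃ Cbar : ℝ, ∀ C : ℝ, Cbar < C →
      (∃ a g, IsOptimal φ w κ a₀ g₀ C a g) ∧
      ∀ a g, IsOptimal φ w κ a₀ g₀ C a g →
        NetworkIso g (w • completeBipartiteNetwork (n / 2) ((n + 1) / 2)) := by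
  have hl := bipartite_radius_lt_one hφ hn he ho
  set p := n / 2 with hp
  set q := (n + 1) / 2 with hq
  have hpq : p + q = n := by omega
  have hp0 : 0 < p := by omega
  have hq0 : 0 < q := by omega
  have hM1 : (1 : ℝ) ≤ (p : ℝ) * q := by exact_mod_cast Nat.mul_pos hp0 hq0
  have hl' : -φ * (w * √((p : ℝ) * q - 1)) < -φ * (w * √((p : ℝ) * q)) := by
    have : √((p : ℝ) * q - 1) < √((p : ℝ) * q) := Real.sqrt_lt_sqrt (by linarith) (by linarith)
    have h1 : 0 < -φ * w := mul_pos (by linarith) hw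
    nlinarith
  have hcount : ∀ x : Fin n → ℝ, numPos x + numPos (-x) ≤ n := fun x => by
    have := numPos_add_numPos_neg x
    omega
  have hle : ∀ {k : ℝ} {x : Fin n → ℝ} {g : Matrix (Fin n) (Fin n) ℝ}, g ∈ networks n w →
      (numPos x : ℝ) * numPos (-x) ≤ k → φ * (x ⬝ᵥ g *ᵥ x) ≤ -φ * (w * √k) * (x ⬝ᵥ x) := by
    intro k x g hg hk
    have := mul_le_mul_of_nonneg_left (neg_dotProduct_mulVec_le hg hw.le hk) (neg_pos.mpr hφ).le
    linarith
  have hbal : ∀ x : Fin n → ℝ, ((numPos x = p ∧ numPos (-x) = q) ∨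
      (numPos x = q ∧ numPos (-x) = p)) ∨
      (numPos x : ℝ) * numPos (-x) ≤ (p : ℝ) * q - 1 := by
    intro x
    rcases mul_lt_or_balanced hn (hcount x) with h | h
    · right
      have : ((numPos x * numPos (-x) + 1 : ℕ) : ℝ) ≤ (p * q : ℕ) := by exact_mod_cast h
      push_cast at this
      linarith
    · exact Or.inl h
  have hform : FormBound n φ w (-φ * (w * √((p : ℝ) * q))) := by
    intro g hg x
    refine hle hg ?_
    rcases hbal x with (⟨h1, h2⟩ | ⟨h1, h2⟩) | h
    · rw [h1, h2]
    · rw [h1, h2, mul_comm]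
    · linarith
  have hQ : ∀ x : Fin n → ℝ, ((numPos x = p ∧ numPos (-x) = q) ∨
      (numPos x = q ∧ numPos (-x) = p)) → ∀ i, x i ≠ 0 := by
    intro x hx i hi
    have h1 := numPos_add_numPos_neg x
    have h2 : 0 < (Finset.univ.filter fun i => x i = 0).card :=
      Finset.card_pos.mpr ⟨i, by simp [hi]⟩
    omega
  have hsqrt : 0 < √(q : ℝ) := Real.sqrt_pos.mpr (by exact_mod_cast hq0)
  obtain ⟨Cbar, hC⟩ := exists_budget_forall_isOptimal (a₀ := a₀) hκ hφ.ne hg₀ hl hl' hQ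
    (fun g hg x => (hbal x).imp_right (hle hg)) hform
    (u₀ := fun i => if i.val < p then √(q : ℝ) else -√(p : ℝ))
    (fun h => by simpa [hp0, hsqrt.ne', hq0.ne'] using congrFun h ⟨0, by omega⟩)
    (initialBipartite_mem n p hw.le)
    (by rw [initialBipartite_mulVec hpq, smul_smul]; congr 1; ring)
  refine ⟨max Cbar 0, fun C hlt => ⟨exists_isOptimal hκ hg₀ hform hl
    ((le_max_right _ _).trans hlt.le), fun a g hopt => ?_⟩⟩
  obtain ⟨x, hx, hlink⟩ := hC C ((le_max_left _ _).trans_lt hlt) a g hopt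
  have hneg : ∀ i j, x i * x j < 0 → g i j = w := by
    intro i j h
    have hij : i ≠ j := by
      rintro rfl
      exact absurd h (mul_self_nonneg _).not_gt
    exact (hlink i j hij).1 (mul_pos_of_neg_of_neg hφ h)
  have hpos : ∀ i j, i ≠ j → 0 < x i * x j → g i j = 0 :=
    fun i j hij h => (hlink i j hij).2 (mul_neg_of_neg_of_pos hφ h)
  rcases hx with ⟨h1, h2⟩ | ⟨h1, h2⟩
  · exact networkIso_of_opposite_sign (hQ x (Or.inl ⟨h1, h2⟩)) hopt.1.1.2 hneg hpos h1 h2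
  -- Negating `x` swaps the two parts and leaves the products `x i * x j` unchanged.
  · refine networkIso_of_opposite_sign (x := -x) (fun i => ?_) hopt.1.1.2 ?_ ?_ h2
      (by rwa [neg_neg])
    · simpa using hQ x (Or.inr ⟨h1, h2⟩) i
    · simpa using hneg
    · simpa using hpos

theorem networkIso_zero (h : n ≤ 1 ∨ w = 0) {p q : ℕ} (hpq : p + q = n) :
    NetworkIso (0 : Matrix (Fin n) (Fin n) ℝ) (w • completeBipartiteNetwork p q) := by
  refine ⟨(finCongr hpq.symm).trans finSumFinEquiv.symm, fun i j => ?_⟩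
  rcases h with h | rfl
  · obtain rfl : i = j := Fin.ext (by omega)
    simp [completeBipartiteNetwork_apply]
  · simp

end Cases

theorem natCeil_half (n : ℕ) : ⌈(n : ℝ) / 2⌉₊ = (n + 1) / 2 := by
  refine le_antisymm (Nat.ceil_le.mpr ?_) ?_
  · have : ((n : ℕ) : ℝ) ≤ (2 * ((n + 1) / 2) : ℕ) := by exact_mod_cast (by omega)
    push_cast at this ⊢
    linarith
  · have h := Nat.le_ceil ((n : ℝ) / 2)
    have : (n : ℝ) ≤ (2 * ⌈(n : ℝ) / 2⌉₊ : ℕ) := by push_cast; linarith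
    have : n ≤ 2 * ⌈(n : ℝ) / 2⌉₊ := by exact_mod_cast this
    omega

end NetworkIntervention

open NetworkIntervention
theorem theorem2 (n : ℕ) (φ w κ : ℝ) (hκ : 0 < κ)
    (a₀ : Fin n → ℝ) (g₀ : Matrix (Fin n) (Fin n) ℝ) (hg₀ : g₀ ∈ networks n w)
    (hw : WeightBound n φ w) :
    (0 < φ → ∃ Cbar : ℝ, ∀ C : ℝ, Cbar < C →
      (∃ a g, IsOptimal φ w κ a₀ g₀ C a g) ∧
      ∀ a g, IsOptimal φ w κ a₀ g₀ C a g → g = w • completeNetwork n) ∧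
    (φ < 0 → ∃ Cbar : ℝ, ∀ C : ℝ, Cbar < C →
      (∃ a g, IsOptimal φ w κ a₀ g₀ C a g) ∧
      ∀ a g, IsOptimal φ w κ a₀ g₀ C a g →
        NetworkIso g (w • completeBipartiteNetwork ⌊(n : ℝ) / 2⌋₊ ⌈(n : ℝ) / 2⌉₊)) := by
  have hfloor : ⌊(n : ℝ) / 2⌋₊ = n / 2 := by exact_mod_cast Nat.floor_div_eq_div (K := ℝ) n 2
  rw [hfloor, natCeil_half]
  -- In this degenerate case the zero matrix is the only network and the gap `l' < l` is not
  -- available, but the form bound `l = 0` still gives existence.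
  by_cases ht : n ≤ 1 ∨ w = 0
  · have hex : ∀ C : ℝ, 0 < C → ∃ a g, IsOptimal φ w κ a₀ g₀ C a g := fun C hC =>
      exists_isOptimal hκ.le hg₀ (formBound_zero ht) one_pos hC.le
    refine ⟨fun _ => ⟨0, fun C hC => ⟨hex C hC, fun a g ho => ?_⟩⟩,
      fun _ => ⟨0, fun C hC => ⟨hex C hC, fun a g ho => ?_⟩⟩⟩
    · obtain rfl : g = 0 := networks_eq_zero ht ho.1.1
      rcases ht with h | rfl
      · ext i j
        obtain rfl : i = j := Fin.ext (by omega)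
        simp [completeNetwork]
      · simp
    · obtain rfl : g = 0 := networks_eq_zero ht ho.1.1
      exact networkIso_zero ht (by omega)
  · push Not at ht
    have hn : 2 ≤ n := ht.1
    -- Any entry of `g₀`, even a diagonal one, witnesses `0 ≤ w`.
    have h0 := (hg₀.1 ⟨0, by omega⟩ ⟨0, by omega⟩).2
    have hw0 : 0 < w := lt_of_le_of_ne (h0.1.trans h0.2) ht.2.symm
    obtain ⟨hb, he, ho⟩ := hw hn
    exact ⟨fun hφ => exists_budget_complete hκ.le hφ hw0 hn hg₀ (hb hφ),
      fun hφ => exists_budget_bipartite hκ.le hφ hw0 hn hg₀ (he hφ) (ho hφ)⟩
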